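/- Let $G$ be a finite simple graph without isolated vertices, and let $q$ be a positive integer. For a finite graph $F$, let $c_q(F)$ denote the number of proper $q$-colorings of $F$, that is, of maps $V(F)\to\{1,\dots,q\}$ that assign different colors to adjacent vertices (the colors are labeled). Let $d_v$ be the degree of the vertex $v$ in $G$, and let $K_{a,b}$ be the complete bipartite graph with parts of sizes $a$ and $b$. Then \[ c_q(G) \le \prod_{uv \in E(G)} c_q(K_{d_u,d_v})^{1/(d_u d_v)}, \] where the product is over the (unordered) edges of $G$. -/

import Mathlib

namespace ColorCount

/-- `c_q(G)`: the number of proper colorings of `G` with the `q` labeled colors `Fin q`. -/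
noncomputable def numColorings {V : Type*} (q : ℕ) (G : SimpleGraph V) : ℕ :=
  Nat.card (G.Coloring (Fin q))

/-- `c_q(K_{a,b})`. -/
noncomputable def bicliqueColorings (q a b : ℕ) : ℕ :=
  numColorings q (completeBipartiteGraph (Fin a) (Fin b))

theorem bicliqueColorings_comm (q a b : ℕ) :
    bicliqueColorings q a b = bicliqueColorings q b a := by
  refine Nat.card_congr (SimpleGraph.coloringCongr
    (⟨Equiv.sumComm (Fin a) (Fin b), ?_⟩ :
      completeBipartiteGraph (Fin a) (Fin b) ≃g completeBipartiteGraph (Fin b) (Fin a))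
    (Equiv.refl (Fin q)))
  rintro (x | x) (y | y) <;> simp

/-- The factor `c_q(K_{d_u,d_v}) ^ (1 / (d_u d_v))` of an unordered pair `uv`. -/
noncomputable def edgeFactor {V : Type*} [Fintype V] (G : SimpleGraph V) [DecidableRel G.Adj]
    (q : ℕ) : Sym2 V → ℝ :=
  Sym2.lift ⟨fun u v =>
    (bicliqueColorings q (G.degree u) (G.degree v) : ℝ) ^
      (1 / ((G.degree u : ℝ) * (G.degree v : ℝ))),
    fun u v => by
      beta_reduce
      rw [bicliqueColorings_comm, mul_comm (G.degree u : ℝ)]⟩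

end ColorCount

open Finset
open scoped NNReal

namespace ColorCount

/-! The bound is proved for list colorings, which allows induction: the edge `uv` contributes the
number of list colorings of $K_{d_u,d_v}$ to the power $1/(d_u d_v)$, and an isolated vertex
contributes its list size. Let `w` have maximum degree `D > 0`. Giving `w` the color `c` deletes its
edges and erases `c` from its neighbors' lists, so by induction it suffices that the bounds of the
residual instances, summed over `c`, are at most the bound of `G` (`sum_listBound_residual_le`).

Factors away from `w` and its neighbors do not depend on `c`. The rest splits into one factor per
neighbor `v` of `w`, and Hölder with exponent `D` separates the neighbors. If `v` has degree `a >
1`, Hölder over its `a - 1` other edges leaves one sum per edge; the dual Hölder inequality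
`sum_rpow_sum_filter_le` bounds it by the old edge factor and a common term that pays exactly for
the edge `vw`. It needs the other end's degree to be at most `D`, hence the choice of `w`.

An edge between two neighbors of `w` loses `c` at both ends. `listBiclique_erase_erase_rpow_le`
replaces the second loss by a ratio of list sizes, which is then charged to the opposite end. -/

/-! ### Weighted Hölder inequalities for finite sums -/

/-- The weighted Hölder inequality for finitely many functions on a finite set. -/
theorem sum_prod_rpow_le {ι κ : Type*} (s : Finset κ) (t : Finset ι) (f : ι → κ → ℝ≥0)
    (w : ι → ℝ) (hw : ∀ i, 0 ≤ w i) (hw1 : ∑ i ∈ t, w i = 1) :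
    ∑ c ∈ s, ∏ i ∈ t, f i c ^ w i ≤ ∏ i ∈ t, (∑ c ∈ s, f i c) ^ w i := by
  by_cases h : ∃ i ∈ t, w i ≠ 0 ∧ ∑ c ∈ s, f i c = 0
  · obtain ⟨i, hi, hwi, hS⟩ := h
    rw [Finset.sum_eq_zero]
    · exact zero_le
    · intro c hc
      refine Finset.prod_eq_zero hi ?_
      rw [Finset.sum_eq_zero_iff.1 hS c hc, NNReal.zero_rpow hwi]
  · push Not at h
    -- Weighted AM-GM, applied pointwise to the functions normalized by their sums.
    have key : ∀ c ∈ s, ∏ i ∈ t, f i c ^ w i ≤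
        (∏ i ∈ t, (∑ c ∈ s, f i c) ^ w i) * ∑ i ∈ t, (w i).toNNReal * (f i c / ∑ c ∈ s, f i c) := by
      intro c _
      have h1 : ∏ i ∈ t, f i c ^ w i =
          (∏ i ∈ t, (∑ c ∈ s, f i c) ^ w i) * ∏ i ∈ t, (f i c / ∑ c ∈ s, f i c) ^ w i := by
        rw [← Finset.prod_mul_distrib]
        refine Finset.prod_congr rfl fun i hi => ?_
        by_cases hwi : w i = 0
        · simp [hwi]
        · rw [← NNReal.mul_rpow, mul_div_cancel₀ _ (h i hi hwi)]
      rw [h1]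
      gcongr
      have h2 := NNReal.geom_mean_le_arith_mean_weighted t (fun i => (w i).toNNReal)
        (fun i => f i c / ∑ c ∈ s, f i c) (by
          rw [← Real.toNNReal_sum_of_nonneg (fun i _ => hw i), hw1, Real.toNNReal_one])
      simpa [Real.coe_toNNReal _ (hw _)] using h2
    refine (Finset.sum_le_sum key).trans ?_
    rw [← Finset.mul_sum, Finset.sum_comm]
    refine mul_le_of_le_one_right zero_le ?_
    calc ∑ i ∈ t, ∑ c ∈ s, (w i).toNNReal * (f i c / ∑ c ∈ s, f i c)
        ≤ ∑ i ∈ t, (w i).toNNReal := by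
          refine Finset.sum_le_sum fun i _ => ?_
          rw [← Finset.mul_sum, ← Finset.sum_div]
          exact mul_le_of_le_one_right zero_le (div_self_le_one _)
      _ = 1 := by
          rw [← Real.toNNReal_sum_of_nonneg (fun i _ => hw i), hw1, Real.toNNReal_one]

/-- The weighted Hölder inequality for two functions on a finite set. -/
theorem sum_rpow_mul_rpow_le {κ : Type*} (s : Finset κ) (f g : κ → ℝ≥0) (θ : ℝ) (h0 : 0 ≤ θ)
    (h1 : θ ≤ 1) :
    ∑ c ∈ s, f c ^ θ * g c ^ (1 - θ) ≤ (∑ c ∈ s, f c) ^ θ * (∑ c ∈ s, g c) ^ (1 - θ) := by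
  have := sum_prod_rpow_le s (univ : Finset (Fin 2)) ![f, g] ![θ, 1 - θ]
    (by intro i; fin_cases i <;> simp [h0, h1]) (by simp)
  simpa [Fin.prod_univ_two] using this

/-- The Hölder inequality with equal weights. -/
theorem sum_prod_rpow_inv_card_le {ι κ : Type*} (s : Finset κ) (t : Finset ι) (ht : t.Nonempty)
    (f : ι → κ → ℝ≥0) :
    ∑ c ∈ s, ∏ i ∈ t, f i c ^ (1 / (#t : ℝ)) ≤ ∏ i ∈ t, (∑ c ∈ s, f i c) ^ (1 / (#t : ℝ)) := by
  have : (#t : ℝ) ≠ 0 := by exact_mod_cast ht.card_pos.ne'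
  exact sum_prod_rpow_le s t f (fun _ => 1 / (#t : ℝ)) (fun _ => by positivity)
    (by simp [this])

/-! ### List colorings of complete bipartite graphs -/

section Biclique

variable {α : Type*} [DecidableEq α]

/-- The number of colors of the list `B` that the tuple `x` does not use. -/
def avail (B : Finset α) {n : ℕ} (x : Fin n → α) : ℕ := #{c ∈ B | ∀ i, x i ≠ c}

/-- The number of proper list colorings of the complete bipartite graph in which the vertices of
degree `a` (there are `b` of them) have the list `A` and those of degree `b` have the list `B`. -/
def listBiclique (a b : ℕ) (A B : Finset α) : ℕ :=
  ∑ x ∈ Fintype.piFinset (fun _ : Fin b => A), avail B x ^ a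

theorem avail_eq_sum {n : ℕ} (B : Finset α) (x : Fin n → α) :
    avail B x = ∑ c ∈ B, ∏ i, if x i ≠ c then 1 else 0 := by
  simp only [avail, Finset.card_filter, Finset.prod_ite_zero, Finset.prod_const_one, mem_univ,
    true_imp_iff]

theorem avail_pow {n : ℕ} (a : ℕ) (B : Finset α) (x : Fin n → α) :
    avail B x ^ a =
      ∑ y ∈ Fintype.piFinset (fun _ : Fin a => B), ∏ j, ∏ i, if x i ≠ y j then 1 else 0 := by
  rw [avail_eq_sum, Finset.sum_pow']

theorem listBiclique_comm (a b : ℕ) (A B : Finset α) :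
    listBiclique a b A B = listBiclique b a B A := by
  simp only [listBiclique, avail_pow]
  rw [Finset.sum_comm]
  refine Finset.sum_congr rfl fun y _ => Finset.sum_congr rfl fun x _ => ?_
  rw [Finset.prod_comm]
  simp only [ne_comm]

/-- A dual form of Hölder's inequality for the incidence between colors and tuples of colors. -/
theorem sum_rpow_sum_filter_le (a k D : ℕ) (ha : 0 < a) (hk : 0 < k) (hkD : k ≤ D)
    (A C : Finset α) (g : (Fin k → α) → ℝ≥0) :
    ∑ c ∈ C, (∑ z ∈ Fintype.piFinset (fun _ : Fin k => A) with ∀ i, z i ≠ c,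
        g z ^ (1 - 1 / a : ℝ)) ^ ((D : ℝ) / k) ≤
      (∑ z ∈ Fintype.piFinset (fun _ : Fin k => A), g z) ^ ((D : ℝ) / k * (1 - 1 / a)) *
        (listBiclique D a C A : ℝ≥0) ^ (1 / a : ℝ) := by
  have ha' : (a : ℝ) ≠ 0 := by positivity
  have hk' : (k : ℝ) ≠ 0 := by positivity
  have hD' : (D : ℝ) ≠ 0 := by have := hk.trans_le hkD; positivity
  -- This is where `k ≤ D` enters: `1 / p` has to be an admissible Hölder weight.
  have hp1 : 1 ≤ (D : ℝ) / k := by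
    rw [le_div_iff₀ (by positivity), one_mul]
    exact_mod_cast hkD
  set p : ℝ := (D : ℝ) / k with hp
  have hp0 : p ≠ 0 := by positivity
  have hpinv : 1 / p ≤ 1 := by rw [div_le_one (by positivity)]; exact hp1
  set Z := Fintype.piFinset (fun _ : Fin k => A) with hZ
  set T : α → ℝ≥0 := fun c => ∑ z ∈ Z with ∀ i, z i ≠ c, g z ^ (1 - 1 / a : ℝ) with hT
  set S := ∑ c ∈ C, T c ^ p with hS
  set U : (Fin k → α) → ℝ≥0 := fun z => ∑ c ∈ C, T c ^ (p - 1) * ∏ i, if z i ≠ c then 1 else 0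
    with hU
  have hind : ∀ c, T c = ∑ z ∈ Z, g z ^ (1 - 1 / a : ℝ) * ∏ i, if z i ≠ c then 1 else 0 := by
    intro c
    simp only [hT, Finset.sum_filter, Finset.prod_ite_zero, Finset.prod_const_one, mem_univ,
      true_imp_iff, mul_ite, mul_one, mul_zero]
  -- Duality: split `T c ^ p = T c ^ (p - 1) * T c`, expand the last factor and exchange the sums.
  have hSU : S = ∑ z ∈ Z, g z ^ (1 - 1 / a : ℝ) * (U z ^ a) ^ (1 - (1 - 1 / a) : ℝ) := by
    have h1 : ∀ c ∈ C, T c ^ p =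
        ∑ z ∈ Z, g z ^ (1 - 1 / a : ℝ) * (T c ^ (p - 1) * ∏ i, if z i ≠ c then 1 else 0) := by
      intro c _
      have : T c ^ p = T c ^ (p - 1) * T c := by
        rw [← NNReal.rpow_add_one' (by simpa using hp0), sub_add_cancel]
      rw [this]
      conv_lhs =>
        rhs
        rw [hind c]
      rw [Finset.mul_sum]
      exact Finset.sum_congr rfl fun z _ => by ring
    rw [hS, Finset.sum_congr rfl h1, Finset.sum_comm]
    refine Finset.sum_congr rfl fun z _ => ?_
    rw [← Finset.mul_sum, sub_sub_cancel, one_div, NNReal.pow_rpow_inv_natCast _ ha.ne']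
  -- Expanding the `a`-th power gives a sum over `y` in `C ^ a`; summing over `z` first turns the
  -- incidences into `avail A y ^ k`. Hölder then brings back `S` itself.
  have hUa : ∑ z ∈ Z, U z ^ a ≤ (listBiclique D a C A : ℝ≥0) ^ (1 / p) * (S ^ a) ^ (1 - 1 / p) := by
    have h2 : ∑ z ∈ Z, U z ^ a = ∑ y ∈ Fintype.piFinset (fun _ : Fin a => C),
        ((avail A y : ℝ≥0) ^ D) ^ (1 / p) * (∏ j, T (y j) ^ p) ^ (1 - 1 / p) := by
      simp only [hU, Finset.sum_pow']
      rw [Finset.sum_comm]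
      refine Finset.sum_congr rfl fun y _ => ?_
      have h3 : ((avail A y : ℝ≥0) ^ D) ^ (1 / p) = (avail A y : ℝ≥0) ^ k := by
        rw [← NNReal.rpow_natCast, ← NNReal.rpow_mul, ← NNReal.rpow_natCast _ k, hp]
        congr 1
        field_simp
      rw [h3, ← Nat.cast_pow, avail_pow, ← NNReal.finsetProd_rpow]
      push_cast
      rw [Finset.sum_mul]
      refine Finset.sum_congr rfl fun z _ => ?_
      rw [Finset.prod_mul_distrib, mul_comm, Finset.prod_comm]
      congr 1
      · simp only [ne_comm]
      · refine Finset.prod_congr rfl fun j _ => ?_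
        rw [← NNReal.rpow_mul]
        congr 1
        field_simp
    rw [h2]
    refine (sum_rpow_mul_rpow_le _ _ _ (1 / p) (by positivity) hpinv).trans (le_of_eq ?_)
    rw [hS, Finset.sum_pow', listBiclique]
    push_cast
    rfl
  by_cases hS0 : S = 0
  · rw [hS0]; exact zero_le
  set Γ := ∑ z ∈ Z, g z with hΓ
  set F : ℝ≥0 := (listBiclique D a C A : ℝ≥0) with hF
  have ha1 : (1 : ℝ) / a ≤ 1 := by
    rw [div_le_one (by positivity)]; exact_mod_cast ha
  have hmain : S ≤ Γ ^ (1 - 1 / a : ℝ) * (F ^ (1 / p) * (S ^ a) ^ (1 - 1 / p)) ^ (1 / a : ℝ) := by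
    calc S ≤ Γ ^ (1 - 1 / a : ℝ) * (∑ z ∈ Z, U z ^ a) ^ (1 - (1 - 1 / a) : ℝ) := by
          rw [hSU]
          exact sum_rpow_mul_rpow_le _ _ _ _ (by linarith) (by
            have : (0 : ℝ) ≤ 1 / a := by positivity
            linarith)
      _ ≤ _ := by
          rw [sub_sub_cancel]
          gcongr
  -- `S` now bounds itself with exponent `1 - 1 / p`; this power is cancelled.
  have hmain2 : S ^ (1 / p) ≤ Γ ^ (1 - 1 / a : ℝ) * F ^ (1 / p * (1 / a)) := by
    have h4 : (F ^ (1 / p) * (S ^ a) ^ (1 - 1 / p)) ^ (1 / a : ℝ) =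
        F ^ (1 / p * (1 / a)) * S ^ (1 - 1 / p) := by
      rw [NNReal.mul_rpow, ← NNReal.rpow_mul, ← NNReal.rpow_natCast, ← NNReal.rpow_mul,
        ← NNReal.rpow_mul]
      congr 2
      field_simp
    rw [h4, ← mul_assoc] at hmain
    have h5 : S = S ^ (1 / p) * S ^ (1 - 1 / p) := by
      rw [← NNReal.rpow_add hS0, add_sub_cancel, NNReal.rpow_one]
    have h6 : 0 < S ^ (1 - 1 / p) := NNReal.rpow_pos (pos_iff_ne_zero.2 hS0)
    refine le_of_mul_le_mul_right ?_ h6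
    rw [← h5]
    exact hmain
  calc S = (S ^ (1 / p)) ^ p := by
        rw [← NNReal.rpow_mul, one_div_mul_cancel hp0, NNReal.rpow_one]
    _ ≤ (Γ ^ (1 - 1 / a : ℝ) * F ^ (1 / p * (1 / a))) ^ p := by gcongr
    _ = Γ ^ (p * (1 - 1 / a)) * F ^ (1 / a : ℝ) := by
        rw [NNReal.mul_rpow, ← NNReal.rpow_mul, ← NNReal.rpow_mul]
        congr 2
        · ring
        · field_simp

/-- The dual Hölder inequality for the weight counting the extensions of a tuple of colors. -/
theorem sum_listBiclique_erase_rpow_le (a b D : ℕ) (ha : 0 < a) (hb : 0 < b) (hbD : b ≤ D)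
    (A B C : Finset α) :
    ∑ c ∈ C, (listBiclique (a - 1) b (A.erase c) B : ℝ≥0) ^ ((D : ℝ) / b) ≤
      (listBiclique a b A B : ℝ≥0) ^ ((D : ℝ) / b * (1 - 1 / a)) *
        (listBiclique D a C A : ℝ≥0) ^ (1 / a : ℝ) := by
  have h := sum_rpow_sum_filter_le a b D ha hb hbD A C (fun z => (avail B z : ℝ≥0) ^ a)
  have h1 : (listBiclique a b A B : ℝ≥0) =
      ∑ z ∈ Fintype.piFinset (fun _ : Fin b => A), (avail B z : ℝ≥0) ^ a := by
    simp [listBiclique]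
  rw [h1]
  refine le_of_eq_of_le (Finset.sum_congr rfl fun c _ => ?_) h
  congr 1
  rw [listBiclique]
  push_cast
  refine Finset.sum_congr ?_ fun z _ => ?_
  · ext z
    simp only [Fintype.mem_piFinset, mem_erase, mem_filter]
    exact ⟨fun h => ⟨fun i => (h i).2, fun i => (h i).1⟩, fun h i => ⟨h.2 i, h.1 i⟩⟩
  · rw [← NNReal.rpow_natCast, ← NNReal.rpow_natCast, ← NNReal.rpow_mul, Nat.cast_sub ha]
    congr 1
    have : (a : ℝ) ≠ 0 := by positivity
    field_simp
    simp

/-- The dual Hölder inequality for the constant weight. -/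
theorem sum_card_erase_pow_le (a D : ℕ) (ha : 0 < a) (hD : 0 < D) (A C : Finset α) :
    ∑ c ∈ C, (#(A.erase c) : ℝ≥0) ^ (D : ℝ) ≤
      (#A : ℝ≥0) ^ ((D : ℝ) * (1 - 1 / a)) * (listBiclique D a C A : ℝ≥0) ^ (1 / a : ℝ) := by
  have h := sum_rpow_sum_filter_le a 1 D ha one_pos hD A C (fun _ => 1)
  have h1 : ∀ c, #{z ∈ Fintype.piFinset (fun _ : Fin 1 => A) | ¬ z 0 = c} = #(A.erase c) := by
    intro c
    rw [← Fintype.card_piFinset_const (A.erase c) 1 |>.trans (pow_one _)]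
    congr 1
    ext z
    simp [and_comm]
  simpa [h1] using h

/-- An unused color `c` of `B` counts both as available and as an element, so with `m` available
colors among the `n` others the claim is `m (n + 1) ≤ (m + 1) n`, that is, `m ≤ n`. -/
theorem avail_erase_mul_card_le {n : ℕ} (B : Finset α) (c : α) (x : Fin n → α)
    (hx : ∀ i, x i ≠ c) : avail (B.erase c) x * #B ≤ avail B x * #(B.erase c) := by
  by_cases hc : c ∈ B
  · have h1 : avail B x = avail (B.erase c) x + 1 := by
      have : {d ∈ B | ∀ i, x i ≠ d} = insert c {d ∈ B.erase c | ∀ i, x i ≠ d} := by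
        ext d
        by_cases hd : d = c
        · subst hd; simp [hc]; exact hx
        · simp [hd]
      rw [avail, this, card_insert_of_notMem (by simp), avail]
    have h2 : #B = #(B.erase c) + 1 := (card_erase_add_one hc).symm
    have h3 : avail (B.erase c) x ≤ #(B.erase c) := card_filter_le _ _
    rw [h1, h2]
    nlinarith
  · rw [erase_eq_of_notMem hc]

theorem listBiclique_erase_erase_mul_le (n b : ℕ) (A B : Finset α) (c : α) :
    listBiclique n b (A.erase c) (B.erase c) * #B ^ n ≤
      listBiclique n b (A.erase c) B * #(B.erase c) ^ n := by
  simp only [listBiclique, Finset.sum_mul, ← mul_pow]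
  refine Finset.sum_le_sum fun x hx => Nat.pow_le_pow_left (avail_erase_mul_card_le B c x ?_) n
  intro i
  exact (mem_erase.1 (Fintype.mem_piFinset.1 hx i)).1

/-- Power mean inequality for bicliques when the size of one part grows. -/
theorem listBiclique_pred_le (n b : ℕ) (hb : 0 < b) (A B : Finset α) :
    (listBiclique n (b - 1) A B : ℝ≥0) ≤
      (listBiclique n b A B : ℝ≥0) ^ (1 - 1 / b : ℝ) * ((#B : ℝ≥0) ^ n) ^ (1 / b : ℝ) := by
  have hb' : (b : ℝ) ≠ 0 := by positivity
  have hb1 : (1 : ℝ) / b ≤ 1 := by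
    rw [div_le_one (by positivity)]; exact_mod_cast hb
  rw [listBiclique_comm, listBiclique_comm n b]
  have h := sum_rpow_mul_rpow_le (Fintype.piFinset (fun _ : Fin n => B))
    (fun y => (avail A y : ℝ≥0) ^ b) (fun _ => 1) (1 - 1 / b : ℝ) (by linarith) (by
      have : (0 : ℝ) ≤ 1 / b := by positivity
      linarith)
  simp only [listBiclique]
  push_cast
  refine le_of_eq_of_le (Finset.sum_congr rfl fun y _ => ?_) (h.trans (le_of_eq ?_))
  · rw [← NNReal.rpow_natCast, ← NNReal.rpow_natCast, ← NNReal.rpow_mul, Nat.cast_sub hb,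
      NNReal.one_rpow, mul_one]
    congr 1
    field_simp
    simp
  · simp

/-- Comparison used for an edge inside the neighborhood of a removed vertex of color `c`. -/
theorem listBiclique_erase_erase_rpow_le (n b : ℕ) (hn : 0 < n) (hb : 1 < b) (A B : Finset α)
    (c : α) :
    (listBiclique n (b - 1) (A.erase c) (B.erase c) : ℝ≥0) ^ (1 / (n * ((b - 1 : ℕ) : ℝ))) ≤
      (listBiclique n b (A.erase c) B : ℝ≥0) ^ (1 / (n * b : ℝ)) *
        ((#(B.erase c) : ℝ≥0) ^ (1 / ((b - 1 : ℕ) : ℝ)) * ((#B : ℝ≥0) ^ (1 / b : ℝ))⁻¹) := by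
  have hn' : (n : ℝ) ≠ 0 := by positivity
  have hb' : (b : ℝ) ≠ 0 := by positivity
  have hb1 : (b : ℝ) - 1 ≠ 0 := by
    have : (1 : ℝ) < b := by exact_mod_cast hb
    linarith
  have hbc : ((b - 1 : ℕ) : ℝ) = b - 1 := by rw [Nat.cast_sub hb.le, Nat.cast_one]
  -- For empty `B` the inverse on the right is `0` by convention, so the left side must vanish; this
  -- uses `0 < n`.
  by_cases hB : #B = 0
  · rw [card_eq_zero] at hB
    subst hB
    have : listBiclique n (b - 1) (A.erase c) (∅ : Finset α) = 0 := by
      simp [listBiclique, avail, hn.ne']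
    rw [erase_empty, this, Nat.cast_zero, NNReal.zero_rpow]
    · exact zero_le
    · rw [hbc]; positivity
  have hB0 : (#B : ℝ≥0) ≠ 0 := by exact_mod_cast hB
  have h1 : (listBiclique n (b - 1) (A.erase c) (B.erase c) : ℝ≥0) * (#B : ℝ≥0) ^ n ≤
      (listBiclique n (b - 1) (A.erase c) B : ℝ≥0) * (#(B.erase c) : ℝ≥0) ^ n := by
    exact_mod_cast listBiclique_erase_erase_mul_le n (b - 1) A B c
  have h2 := listBiclique_pred_le n b (by omega) (A.erase c) B
  set X : ℝ≥0 := (listBiclique n (b - 1) (A.erase c) (B.erase c) : ℝ≥0)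
  set F : ℝ≥0 := (listBiclique n b (A.erase c) B : ℝ≥0)
  set β : ℝ≥0 := (#B : ℝ≥0)
  set γ : ℝ≥0 := (#(B.erase c) : ℝ≥0)
  -- Restoring `c` to `B` costs `(γ / β) ^ n`; raising `b - 1` to `b` costs `β ^ (n / b)`.
  have h3 : X ≤ F ^ (1 - 1 / b : ℝ) * γ ^ (n : ℝ) * β ^ (n * (1 / b - 1) : ℝ) := by
    have h4 : X * β ^ n ≤ F ^ (1 - 1 / b : ℝ) * (β ^ n) ^ (1 / b : ℝ) * γ ^ n := by
      refine h1.trans ?_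
      gcongr
    have h5 : 0 < β ^ n := by positivity
    refine le_of_mul_le_mul_right (h4.trans (le_of_eq ?_)) h5
    have h6 : (β ^ n) ^ (1 / b : ℝ) = β ^ (n * (1 / b - 1) : ℝ) * β ^ n := by
      rw [← NNReal.rpow_natCast, ← NNReal.rpow_mul, ← NNReal.rpow_add hB0]
      congr 1
      ring
    rw [h6, NNReal.rpow_natCast]
    ring
  refine (NNReal.rpow_le_rpow h3 (by positivity : 0 ≤ 1 / (n * ((b - 1 : ℕ) : ℝ)))).trans
    (le_of_eq ?_)
  rw [NNReal.mul_rpow, NNReal.mul_rpow, ← NNReal.rpow_mul, ← NNReal.rpow_mul, ← NNReal.rpow_mul,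
    ← NNReal.rpow_neg, mul_assoc, hbc]
  congr 2
  · field_simp
  · congr 1
    field_simp
  · congr 1
    field_simp
    ring

end Biclique

/-! ### Local inequalities at a neighbor of the removed vertex -/

/-- Hölder's inequality over the edges at a vertex. -/
theorem sum_prod_pow_le {ι κ : Type*} (C : Finset κ) (t : Finset ι) (ht : t.Nonempty) (D : ℕ)
    (γ : ι → κ → ℝ≥0) (K : ι → ℝ≥0) (M : ℝ≥0)
    (h : ∀ u ∈ t, ∑ c ∈ C, γ u c ^ ((#t : ℝ) * D) ≤ K u ^ ((#t : ℝ) * D) * M) :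
    ∑ c ∈ C, (∏ u ∈ t, γ u c) ^ D ≤ (∏ u ∈ t, K u) ^ D * M := by
  have ht0 : (#t : ℝ) ≠ 0 := by exact_mod_cast ht.card_pos.ne'
  have hpow : ∀ x : ℝ≥0, (x ^ ((#t : ℝ) * D)) ^ (1 / (#t : ℝ)) = x ^ D := by
    intro x
    rw [← NNReal.rpow_mul, ← NNReal.rpow_natCast]
    congr 1
    field_simp
  calc ∑ c ∈ C, (∏ u ∈ t, γ u c) ^ D
      = ∑ c ∈ C, ∏ u ∈ t, (γ u c ^ ((#t : ℝ) * D)) ^ (1 / (#t : ℝ)) := by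
        simp only [hpow, Finset.prod_pow]
    _ ≤ ∏ u ∈ t, (∑ c ∈ C, γ u c ^ ((#t : ℝ) * D)) ^ (1 / (#t : ℝ)) :=
        sum_prod_rpow_inv_card_le C t ht _
    _ ≤ ∏ u ∈ t, (K u ^ ((#t : ℝ) * D) * M) ^ (1 / (#t : ℝ)) := by
        refine Finset.prod_le_prod' fun u hu => ?_
        exact NNReal.rpow_le_rpow (h u hu) (by positivity)
    _ = (∏ u ∈ t, K u) ^ D * M := by
        simp only [NNReal.mul_rpow, hpow, Finset.prod_mul_distrib, Finset.prod_pow,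
          Finset.prod_const]
        rw [one_div, NNReal.rpow_inv_natCast_pow _ ht.card_pos.ne']

section Local

variable {α : Type*} [DecidableEq α]

/-- The factor of an edge between a vertex of degree `a` and a vertex of degree `b`, when the color
`c` is removed from the list `A` and one neighbor of the first vertex is deleted. -/
noncomputable def erasedFactor (a b : ℕ) (A B : Finset α) (c : α) : ℝ≥0 :=
  (listBiclique (a - 1) b (A.erase c) B : ℝ≥0) ^ (1 / (((a - 1 : ℕ) : ℝ) * b))

/-- The normalized change of the list size of a vertex of degree `a`. -/
noncomputable def erasedCard (a : ℕ) (A : Finset α) (c : α) : ℝ≥0 :=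
  (#(A.erase c) : ℝ≥0) ^ (1 / ((a - 1 : ℕ) : ℝ)) * ((#A : ℝ≥0) ^ (1 / a : ℝ))⁻¹

theorem sum_erasedFactor_rpow_le (a b D : ℕ) (ha : 1 < a) (hb : 0 < b) (hbD : b ≤ D)
    (A B C : Finset α) :
    ∑ c ∈ C, erasedFactor a b A B c ^ (((a - 1 : ℕ) : ℝ) * D) ≤
      ((listBiclique a b A B : ℝ≥0) ^ (1 / (a * b : ℝ))) ^ (((a - 1 : ℕ) : ℝ) * D) *
        (listBiclique D a C A : ℝ≥0) ^ (1 / a : ℝ) := by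
  have ha0 : (a : ℝ) ≠ 0 := by positivity
  have hb0 : (b : ℝ) ≠ 0 := by positivity
  have hac : ((a - 1 : ℕ) : ℝ) = a - 1 := by rw [Nat.cast_sub ha.le, Nat.cast_one]
  have ha1 : (a : ℝ) - 1 ≠ 0 := by
    have : (1 : ℝ) < a := by exact_mod_cast ha
    linarith
  refine le_of_eq_of_le (Finset.sum_congr rfl fun c _ => ?_)
    ((sum_listBiclique_erase_rpow_le a b D (by omega) hb hbD A B C).trans (le_of_eq ?_))
  · rw [erasedFactor, ← NNReal.rpow_mul, hac]
    congr 1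
    field_simp
  · rw [← NNReal.rpow_mul, hac]
    congr 2
    field_simp

/-- The normalization in `erasedCard` cancels the power of `#A` in `sum_card_erase_pow_le`, leaving
only the common term for the edge to the removed vertex. -/
theorem sum_erasedCard_rpow_le (a D : ℕ) (ha : 1 < a) (hD : 0 < D) (A C : Finset α) :
    ∑ c ∈ C, erasedCard a A c ^ (((a - 1 : ℕ) : ℝ) * D) ≤
      (listBiclique D a C A : ℝ≥0) ^ (1 / a : ℝ) := by
  have ha0 : (a : ℝ) ≠ 0 := by positivity
  have hac : ((a - 1 : ℕ) : ℝ) = a - 1 := by rw [Nat.cast_sub ha.le, Nat.cast_one]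
  have ha1 : (a : ℝ) - 1 ≠ 0 := by
    have : (1 : ℝ) < a := by exact_mod_cast ha
    linarith
  have h : ∀ c ∈ C, erasedCard a A c ^ (((a - 1 : ℕ) : ℝ) * D) =
      (#(A.erase c) : ℝ≥0) ^ (D : ℝ) * ((#A : ℝ≥0) ^ ((D : ℝ) * (1 - 1 / a)))⁻¹ := by
    intro c _
    rw [erasedCard, NNReal.mul_rpow, NNReal.inv_rpow, ← NNReal.rpow_mul, ← NNReal.rpow_mul, hac]
    congr 2
    · field_simp
    · congr 1
      field_simp
  rw [Finset.sum_congr rfl h, ← Finset.sum_mul, ← div_eq_mul_inv]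
  refine div_le_of_le_mul₀ zero_le zero_le ?_
  rw [mul_comm]
  exact sum_card_erase_pow_le a D (by omega) hD A C

/-- Cauchy-Schwarz on the two preceding bounds. It serves edges inside the neighborhood, of which
each end carries half; hence the `2` in the exponent. -/
theorem sum_erasedFactor_mul_erasedCard_rpow_le (a b D : ℕ) (ha : 1 < a) (hb : 0 < b)
    (hbD : b ≤ D) (A B C : Finset α) :
    ∑ c ∈ C, ((erasedFactor a b A B c * erasedCard a A c) ^ (1 / 2 : ℝ)) ^
        (((a - 1 : ℕ) : ℝ) * D) ≤
      ((listBiclique a b A B : ℝ≥0) ^ (1 / (2 * (a * b) : ℝ))) ^ (((a - 1 : ℕ) : ℝ) * D) *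
        (listBiclique D a C A : ℝ≥0) ^ (1 / a : ℝ) := by
  set e : ℝ := ((a - 1 : ℕ) : ℝ) * D
  set M : ℝ≥0 := (listBiclique D a C A : ℝ≥0) ^ (1 / a : ℝ)
  have h1 := sum_erasedFactor_rpow_le a b D ha hb hbD A B C
  have h2 := sum_erasedCard_rpow_le a D ha (hb.trans_le hbD) A C
  have h3 := sum_rpow_mul_rpow_le C (fun c => erasedFactor a b A B c ^ e)
    (fun c => erasedCard a A c ^ e) (1 / 2) (by norm_num) (by norm_num)
  rw [show (1 - 1 / 2 : ℝ) = 1 / 2 by norm_num] at h3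
  calc _ = ∑ c ∈ C, (erasedFactor a b A B c ^ e) ^ (1 / 2 : ℝ) *
        (erasedCard a A c ^ e) ^ (1 / 2 : ℝ) := by
        refine Finset.sum_congr rfl fun c _ => ?_
        rw [← NNReal.mul_rpow, ← NNReal.mul_rpow, ← NNReal.rpow_mul, ← NNReal.rpow_mul, mul_comm e]
    _ ≤ _ := h3
    _ ≤ (((listBiclique a b A B : ℝ≥0) ^ (1 / (a * b : ℝ))) ^ e * M) ^ (1 / 2 : ℝ) *
        M ^ (1 / 2 : ℝ) := by gcongr
    _ = _ := by
        rw [NNReal.mul_rpow, mul_assoc, ← NNReal.rpow_add_of_nonneg M (by norm_num) (by norm_num),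
          add_halves, NNReal.rpow_one, ← NNReal.rpow_mul, ← NNReal.rpow_mul, ← NNReal.rpow_mul]
        congr 2
        ring

end Local

/-! ### List colorings and the bound as a product over ordered adjacent pairs -/

section Graph

variable {V α : Type*} [Fintype V]

open Classical in
/-- The set of neighbors of a vertex. -/
noncomputable def nbrs (G : SimpleGraph V) (v : V) : Finset V := {u | G.Adj v u}

theorem mem_nbrs {G : SimpleGraph V} {v u : V} : u ∈ nbrs G v ↔ G.Adj v u := by
  simp [nbrs]

open Classical in
/-- The number of proper colorings of `G` from the lists `L`. -/
noncomputable def listColorings (G : SimpleGraph V) (L : V → Finset α) : ℕ :=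
  #{f ∈ Fintype.piFinset L | ∀ u v, G.Adj u v → f u ≠ f v}

open Classical in
/-- The square root of the factor of the edge `vu` in the bound for list colorings. -/
noncomputable def halfFactor (G : SimpleGraph V) (L : V → Finset α) (v u : V) : ℝ≥0 :=
  (listBiclique #(nbrs G v) #(nbrs G u) (L v) (L u) : ℝ≥0) ^
    (1 / (2 * (#(nbrs G v) * #(nbrs G u)) : ℝ))

/-- The factor of a vertex in the bound for list colorings: it is trivial unless the vertex is
isolated. -/
noncomputable def isolatedFactor (G : SimpleGraph V) (L : V → Finset α) (v : V) : ℝ≥0 :=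
  if #(nbrs G v) = 0 then (#(L v) : ℝ≥0) else 1

/-- The upper bound for the number of list colorings. -/
noncomputable def listBound (G : SimpleGraph V) (L : V → Finset α) : ℝ≥0 :=
  ∏ v, (isolatedFactor G L v * ∏ u ∈ nbrs G v, halfFactor G L v u)

theorem halfFactor_comm (G : SimpleGraph V) (L : V → Finset α) (v u : V) :
    halfFactor G L v u = halfFactor G L u v := by
  classical
  rw [halfFactor, halfFactor, listBiclique_comm, mul_comm (#(nbrs G v) : ℝ)]

open Classical in
/-- The lists that remain after the vertex `w` has got the color `c`. -/
noncomputable def residual (G : SimpleGraph V) (L : V → Finset α) (w : V) (c : α) (v : V) :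
    Finset α :=
  if v = w then {c} else if G.Adj w v then (L v).erase c else L v

/-- Colorings are sorted by the color of `w`. Keeping `w` as an isolated vertex with a one-element
list leaves the vertex type unchanged in the induction. -/
theorem listColorings_le_sum (G : SimpleGraph V) (L : V → Finset α) (w : V) :
    listColorings G L ≤
      ∑ c ∈ L w, listColorings (G.deleteIncidenceSet w) (residual G L w c) := by
  classical
  rw [listColorings, Finset.card_eq_sum_card_fiberwise (f := fun f => f w) (t := L w)]
  · refine Finset.sum_le_sum fun c _ => Finset.card_le_card fun f hf => ?_
    simp only [mem_filter, Fintype.mem_piFinset] at hf ⊢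
    obtain ⟨⟨hL, hG⟩, hc⟩ := hf
    refine ⟨fun v => ?_, fun u v huv => hG u v (G.deleteIncidenceSet_le w huv)⟩
    rw [residual]
    split_ifs with h1 h2
    · rw [h1, hc, mem_singleton]
    · exact mem_erase.2 ⟨hc ▸ (hG w v h2).symm, hL v⟩
    · exact hL v
  · intro f hf
    simp only [coe_filter, Set.mem_ofPred_eq, Fintype.mem_piFinset] at hf
    exact hf.1 w

variable (G : SimpleGraph V) (L : V → Finset α) (w : V)

theorem nbrs_delete_self : nbrs (G.deleteIncidenceSet w) w = ∅ := by
  ext u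
  simp [mem_nbrs, SimpleGraph.deleteIncidenceSet_adj]

open Classical in
theorem nbrs_delete_of_ne {v : V} (hv : v ≠ w) :
    nbrs (G.deleteIncidenceSet w) v = (nbrs G v).erase w := by
  ext u
  simp [mem_nbrs, SimpleGraph.deleteIncidenceSet_adj, hv, and_comm]

theorem nbrs_delete_of_not_adj {v : V} (hv : v ≠ w) (h : ¬ G.Adj w v) :
    nbrs (G.deleteIncidenceSet w) v = nbrs G v := by
  classical
  rw [nbrs_delete_of_ne G w hv, erase_eq_of_notMem]
  rw [mem_nbrs]
  exact fun h' => h h'.symm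

theorem card_nbrs_delete_of_adj {v : V} (h : G.Adj w v) :
    #(nbrs (G.deleteIncidenceSet w) v) = #(nbrs G v) - 1 := by
  classical
  rw [nbrs_delete_of_ne G w h.ne', card_erase_of_mem (mem_nbrs.2 h.symm)]

/-- The vertices other than `w` that are not adjacent to `w`. -/
noncomputable def others : Finset V := by
  classical exact {v | v ≠ w ∧ ¬ G.Adj w v}

theorem mem_others {v : V} : v ∈ others G w ↔ v ≠ w ∧ ¬ G.Adj w v := by
  simp [others]

theorem prod_eq_mul_nbrs_mul_others (f : V → ℝ≥0) :
    ∏ v, f v = f w * ((∏ v ∈ nbrs G w, f v) * ∏ v ∈ others G w, f v) := by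
  classical
  rw [← Finset.mul_prod_erase univ f (mem_univ w), ← Finset.prod_union]
  · congr 2
    ext v
    by_cases h : v = w
    · subst h; simp [mem_nbrs, mem_others]
    · simp only [mem_erase, mem_univ, and_true, mem_union, mem_nbrs, mem_others]
      tauto
  · rw [Finset.disjoint_left]
    intro v hv hv'
    exact ((mem_others G w).1 hv').2 (mem_nbrs.1 hv)

open Classical in
theorem prod_erase_eq_mul {v : V} (f : V → ℝ≥0) :
    ∏ u ∈ (nbrs G v).erase w, f u =
      (∏ u ∈ nbrs G v ∩ nbrs G w, f u) * ∏ u ∈ nbrs G v ∩ others G w, f u := by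
  rw [← Finset.prod_union]
  · congr 1
    ext u
    have : G.Adj w u → u ≠ w := fun h => h.ne'
    simp only [mem_erase, mem_union, mem_inter, mem_nbrs, mem_others]
    tauto
  · rw [Finset.disjoint_left]
    intro u hu hu'
    exact ((mem_others G w).1 (mem_inter.1 hu').2).2 (mem_nbrs.1 (mem_inter.1 hu).2)

open Classical in
/-- The factors of the edges from the other vertices to the neighbors of `w` are moved to the
neighbors of `w`. -/
theorem prod_others_eq_mul (e : V → V → ℝ≥0) (he : ∀ v u, e v u = e u v) :
    ∏ v ∈ others G w, ∏ u ∈ nbrs G v, e v u =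
      (∏ v ∈ others G w, ∏ u ∈ nbrs G v ∩ others G w, e v u) *
        ∏ v ∈ nbrs G w, ∏ u ∈ nbrs G v ∩ others G w, e v u := by
  have h1 : ∀ v ∈ others G w, ∏ u ∈ nbrs G v, e v u =
      (∏ u ∈ nbrs G v ∩ others G w, e v u) * ∏ u ∈ nbrs G v ∩ nbrs G w, e v u := by
    intro v hv
    rw [mem_others] at hv
    rw [mul_comm, ← prod_erase_eq_mul, erase_eq_of_notMem]
    rw [mem_nbrs]
    exact fun h' => hv.2 h'.symm
  rw [Finset.prod_congr rfl h1, Finset.prod_mul_distrib]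
  congr 1
  rw [Finset.prod_comm' (s' := fun u => nbrs G u ∩ others G w) (t' := nbrs G w)]
  · exact Finset.prod_congr rfl fun v _ => Finset.prod_congr rfl fun u _ => he u v
  · intro v u
    simp only [mem_inter, mem_nbrs, G.adj_comm v u]
    tauto

/-- The factor of the bound that does not depend on the color of `w`. -/
noncomputable def farFactor : ℝ≥0 := by
  classical exact (∏ v ∈ others G w, isolatedFactor G L v) *
    ∏ v ∈ others G w, ∏ u ∈ nbrs G v ∩ others G w, halfFactor G L v u

-- Bookkeeping at a neighbor `v` of `w`: it is charged fully for `vw` and for edges leaving the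
-- neighborhood, and by half for edges inside it.
open Classical in
theorem listBound_eq (hw : #(nbrs G w) ≠ 0) :
    listBound G L = farFactor G L w * ∏ v ∈ nbrs G w, (halfFactor G L v w ^ 2 *
      ((∏ u ∈ nbrs G v ∩ nbrs G w, halfFactor G L v u) *
        ∏ u ∈ nbrs G v ∩ others G w, halfFactor G L v u ^ 2)) := by
  rw [listBound, prod_eq_mul_nbrs_mul_others G w, isolatedFactor, if_neg hw, one_mul,
    Finset.prod_mul_distrib (s := others G w), prod_others_eq_mul G w _ (halfFactor_comm G L),
    farFactor]
  have h1 : ∀ v ∈ nbrs G w, isolatedFactor G L v * ∏ u ∈ nbrs G v, halfFactor G L v u =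
      halfFactor G L v w * ((∏ u ∈ nbrs G v ∩ nbrs G w, halfFactor G L v u) *
        ∏ u ∈ nbrs G v ∩ others G w, halfFactor G L v u) := by
    intro v hv
    have hwv : w ∈ nbrs G v := mem_nbrs.2 (mem_nbrs.1 hv).symm
    rw [isolatedFactor, if_neg (card_ne_zero_of_mem hwv), one_mul,
      ← Finset.mul_prod_erase _ _ hwv, prod_erase_eq_mul]
  rw [Finset.prod_congr rfl h1, Finset.prod_congr rfl fun u _ => halfFactor_comm G L w u]
  simp only [Finset.prod_mul_distrib, Finset.prod_pow]
  ring

end Graph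

/-! ### The induction step: fixing the color of a vertex -/

section Residual

variable {V α : Type*} (G : SimpleGraph V) (L : V → Finset α) (w : V)

theorem residual_self (c : α) : residual G L w c w = {c} := by simp [residual]

open Classical in
theorem residual_of_adj (c : α) {v : V} (h : G.Adj w v) :
    residual G L w c v = (L v).erase c := by simp [residual, h, h.ne']

theorem residual_of_not_adj (c : α) {v : V} (hv : v ≠ w) (h : ¬ G.Adj w v) :
    residual G L w c v = L v := by simp [residual, h, hv]

end Residual

section Step

variable {V α : Type*} [Fintype V] (G : SimpleGraph V) (L : V → Finset α) (w : V)

open Classical in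
theorem listBound_residual_eq (c : α) :
    listBound (G.deleteIncidenceSet w) (residual G L w c) =
      farFactor G L w * ∏ v ∈ nbrs G w,
        ((if #(nbrs G v) = 1 then (#((L v).erase c) : ℝ≥0) else 1) *
          ((∏ u ∈ nbrs G v ∩ nbrs G w,
              halfFactor (G.deleteIncidenceSet w) (residual G L w c) v u) *
            ∏ u ∈ nbrs G v ∩ others G w,
              halfFactor (G.deleteIncidenceSet w) (residual G L w c) v u ^ 2)) := by
  set G' := G.deleteIncidenceSet w with hG'
  set R := residual G L w c with hR
  have h0 : isolatedFactor G' R w * ∏ u ∈ nbrs G' w, halfFactor G' R w u = 1 := by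
    simp [isolatedFactor, hG', hR, nbrs_delete_self, residual_self]
  have h1 : ∀ v ∈ nbrs G w, isolatedFactor G' R v * ∏ u ∈ nbrs G' v, halfFactor G' R v u =
      (if #(nbrs G v) = 1 then (#((L v).erase c) : ℝ≥0) else 1) *
        ((∏ u ∈ nbrs G v ∩ nbrs G w, halfFactor G' R v u) *
          ∏ u ∈ nbrs G v ∩ others G w, halfFactor G' R v u) := by
    intro v hv
    rw [mem_nbrs] at hv
    have hwv : #(nbrs G v) ≠ 0 := card_ne_zero_of_mem (mem_nbrs.2 hv.symm)
    rw [isolatedFactor, card_nbrs_delete_of_adj G w hv, hR, residual_of_adj G L w c hv,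
      nbrs_delete_of_ne G w hv.ne', prod_erase_eq_mul]
    congr 1
    -- A neighbor of `w` becomes isolated exactly when `w` was its only neighbor.
    exact if_congr (by omega) rfl rfl
  have h2 : ∀ v ∈ others G w, isolatedFactor G' R v * ∏ u ∈ nbrs G' v, halfFactor G' R v u =
      isolatedFactor G L v * ∏ u ∈ nbrs G v, halfFactor G' R v u := by
    intro v hv
    rw [mem_others] at hv
    rw [isolatedFactor, isolatedFactor, hR, residual_of_not_adj G L w c hv.1 hv.2,
      nbrs_delete_of_not_adj G w hv.1 hv.2]
  have h3 : ∀ v ∈ others G w, ∏ u ∈ nbrs G v ∩ others G w, halfFactor G' R v u =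
      ∏ u ∈ nbrs G v ∩ others G w, halfFactor G L v u := by
    intro v hv
    refine Finset.prod_congr rfl fun u hu => ?_
    rw [mem_others] at hv
    have hu' := (mem_others G w).1 (mem_inter.1 hu).2
    rw [halfFactor, halfFactor, hR, residual_of_not_adj G L w c hv.1 hv.2,
      nbrs_delete_of_not_adj G w hv.1 hv.2, residual_of_not_adj G L w c hu'.1 hu'.2,
      nbrs_delete_of_not_adj G w hu'.1 hu'.2]
  rw [listBound, prod_eq_mul_nbrs_mul_others G w, h0, one_mul, Finset.prod_congr rfl h1,
    Finset.prod_congr rfl h2, Finset.prod_mul_distrib (s := others G w),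
    prod_others_eq_mul G w _ (halfFactor_comm G' R), Finset.prod_congr rfl h3, farFactor]
  simp only [Finset.prod_mul_distrib, Finset.prod_pow]
  ring

open Classical in
theorem halfFactor_residual_le (c : α) {v u : V} (hv : G.Adj w v) (hu : G.Adj w u)
    (huv : G.Adj v u) :
    halfFactor (G.deleteIncidenceSet w) (residual G L w c) v u ≤
      erasedFactor #(nbrs G v) #(nbrs G u) (L v) (L u) c ^ (1 / 2 : ℝ) *
        erasedCard #(nbrs G u) (L u) c ^ (1 / 2 : ℝ) := by
  have hcard : ∀ {x y : V}, G.Adj w x → G.Adj w y → G.Adj x y → 1 < #(nbrs G x) := by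
    intro x y hx hy hxy
    exact Finset.one_lt_card.2 ⟨w, mem_nbrs.2 hx.symm, y, mem_nbrs.2 hxy, hy.ne⟩
  have h1 := hcard hv hu huv
  have h2 := hcard hu hv huv.symm
  have h3 := listBiclique_erase_erase_rpow_le (#(nbrs G v) - 1) #(nbrs G u) (by omega) h2 (L v)
    (L u) c
  rw [halfFactor, card_nbrs_delete_of_adj G w hv, card_nbrs_delete_of_adj G w hu,
    residual_of_adj G L w c hv, residual_of_adj G L w c hu, ← NNReal.mul_rpow, erasedFactor,
    erasedCard]
  refine le_of_eq_of_le ?_ (NNReal.rpow_le_rpow h3 (by norm_num : (0 : ℝ) ≤ 1 / 2))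
  rw [← NNReal.rpow_mul]
  congr 1
  ring

open Classical in
theorem halfFactor_residual_sq (c : α) {v u : V} (hv : G.Adj w v) (hu : u ∈ others G w) :
    halfFactor (G.deleteIncidenceSet w) (residual G L w c) v u ^ 2 =
      erasedFactor #(nbrs G v) #(nbrs G u) (L v) (L u) c := by
  rw [mem_others] at hu
  rw [halfFactor, card_nbrs_delete_of_adj G w hv, nbrs_delete_of_not_adj G w hu.1 hu.2,
    residual_of_adj G L w c hv, residual_of_not_adj G L w c hu.1 hu.2, erasedFactor,
    ← NNReal.rpow_natCast, ← NNReal.rpow_mul]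
  congr 1
  push_cast
  ring

open Classical in
/-- The contribution of a neighbor `v` of `w` after the color of `w` has been fixed. -/
noncomputable def vertexFactor (v : V) (c : α) : ℝ≥0 :=
  (if #(nbrs G v) = 1 then (#((L v).erase c) : ℝ≥0) else 1) *
    ∏ u ∈ (nbrs G v).erase w, if G.Adj w u then
      (erasedFactor #(nbrs G v) #(nbrs G u) (L v) (L u) c *
        erasedCard #(nbrs G v) (L v) c) ^ (1 / 2 : ℝ)
      else erasedFactor #(nbrs G v) #(nbrs G u) (L v) (L u) c

open Classical in
theorem prod_erase_ite_eq_mul (v : V) (f g : V → ℝ≥0) :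
    ∏ u ∈ (nbrs G v).erase w, (if G.Adj w u then f u else g u) =
      (∏ u ∈ nbrs G v ∩ nbrs G w, f u) * ∏ u ∈ nbrs G v ∩ others G w, g u := by
  rw [prod_erase_eq_mul]
  congr 1
  · exact Finset.prod_congr rfl fun u hu => if_pos (mem_nbrs.1 (mem_inter.1 hu).2)
  · exact Finset.prod_congr rfl fun u hu => if_neg ((mem_others G w).1 (mem_inter.1 hu).2).2

/-- `halfFactor_residual_le` leaves the list-size ratio of `u` at the pair `(v, u)`. Exchanging the
ends over the whole product moves it to `u`, so each `vertexFactor` involves only its own vertex's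
ratio and all its sums share one common term. -/
theorem listBound_residual_le (c : α) :
    listBound (G.deleteIncidenceSet w) (residual G L w c) ≤
      farFactor G L w * ∏ v ∈ nbrs G w, vertexFactor G L w v c := by
  classical
  rw [listBound_residual_eq]
  refine mul_le_mul_right ?_ _
  simp only [vertexFactor, prod_erase_ite_eq_mul]
  simp only [Finset.prod_mul_distrib, NNReal.mul_rpow]
  refine mul_le_mul_right (mul_le_mul' ?_ (le_of_eq ?_)) _
  · calc _ ≤ ∏ v ∈ nbrs G w, ∏ u ∈ nbrs G v ∩ nbrs G w,
          (erasedFactor #(nbrs G v) #(nbrs G u) (L v) (L u) c ^ (1 / 2 : ℝ) *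
            erasedCard #(nbrs G u) (L u) c ^ (1 / 2 : ℝ)) := by
          refine Finset.prod_le_prod' fun v hv => Finset.prod_le_prod' fun u hu => ?_
          rw [mem_inter, mem_nbrs, mem_nbrs] at hu
          exact halfFactor_residual_le G L w c (mem_nbrs.1 hv) hu.2 hu.1
      _ = _ := by
          simp only [Finset.prod_mul_distrib]
          congr 1
          refine Finset.prod_comm' fun v u => ?_
          simp only [mem_inter, mem_nbrs, G.adj_comm v u]
          tauto
  · refine Finset.prod_congr rfl fun v hv => Finset.prod_congr rfl fun u hu => ?_
    exact halfFactor_residual_sq G L w c (mem_nbrs.1 hv) (mem_inter.1 hu).2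

open Classical in
theorem sum_vertexFactor_pow_le (hmax : ∀ v, #(nbrs G v) ≤ #(nbrs G w)) {v : V}
    (hv : G.Adj w v) :
    ∑ c ∈ L w, vertexFactor G L w v c ^ #(nbrs G w) ≤
      (halfFactor G L v w ^ 2 * ((∏ u ∈ nbrs G v ∩ nbrs G w, halfFactor G L v u) *
        ∏ u ∈ nbrs G v ∩ others G w, halfFactor G L v u ^ 2)) ^ #(nbrs G w) := by
  have hwv : w ∈ nbrs G v := mem_nbrs.2 hv.symm
  have ha : 0 < #(nbrs G v) := card_pos.2 ⟨w, hwv⟩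
  have hD : 0 < #(nbrs G w) := card_pos.2 ⟨v, mem_nbrs.2 hv⟩
  have hc : #((nbrs G v).erase w) = #(nbrs G v) - 1 := card_erase_of_mem hwv
  -- The `D`-th power of the factor of `vw` is exactly the common term of the local inequalities.
  have hM : (halfFactor G L v w ^ 2) ^ #(nbrs G w) =
      (listBiclique #(nbrs G w) #(nbrs G v) (L w) (L v) : ℝ≥0) ^ (1 / #(nbrs G v) : ℝ) := by
    have : (#(nbrs G v) : ℝ) ≠ 0 := by positivity
    have : (#(nbrs G w) : ℝ) ≠ 0 := by positivity
    rw [halfFactor_comm, halfFactor, ← pow_mul, ← NNReal.rpow_natCast, ← NNReal.rpow_mul]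
    congr 1
    push_cast
    field_simp
  rw [← prod_erase_ite_eq_mul, mul_pow, hM, mul_comm]
  -- With no other edge at `v` there is nothing to apply Hölder to; the list size of the newly
  -- isolated `v` takes its place.
  by_cases h1 : #(nbrs G v) = 1
  · have he : (nbrs G v).erase w = ∅ := by rw [← card_eq_zero, hc, h1]
    simp only [vertexFactor, he, h1, if_true, Finset.prod_empty, mul_one, one_pow, one_mul]
    have := sum_card_erase_pow_le 1 #(nbrs G w) one_pos hD (L v) (L w)
    simpa using this
  · simp only [vertexFactor, if_neg h1, one_mul]
    refine sum_prod_pow_le (L w) ((nbrs G v).erase w) ?_ #(nbrs G w) _ _ _ ?_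
    · rw [← card_pos]; omega
    · intro u hu
      have hb : 0 < #(nbrs G u) :=
        card_pos.2 ⟨v, mem_nbrs.2 (mem_nbrs.1 (mem_of_mem_erase hu)).symm⟩
      rw [hc]
      split_ifs with h
      · exact sum_erasedFactor_mul_erasedCard_rpow_le _ _ _ (by omega) hb (hmax u) _ _ _
      · have h2 : halfFactor G L v u ^ 2 =
            (listBiclique #(nbrs G v) #(nbrs G u) (L v) (L u) : ℝ≥0) ^
              (1 / (#(nbrs G v) * #(nbrs G u) : ℝ)) := by
          rw [halfFactor, ← NNReal.rpow_natCast, ← NNReal.rpow_mul]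
          congr 1
          push_cast
          ring
        rw [h2]
        exact sum_erasedFactor_rpow_le _ _ _ (by omega) hb (hmax u) _ _ _

theorem sum_listBound_residual_le (hmax : ∀ v, #(nbrs G v) ≤ #(nbrs G w))
    (hw : #(nbrs G w) ≠ 0) :
    ∑ c ∈ L w, listBound (G.deleteIncidenceSet w) (residual G L w c) ≤ listBound G L := by
  classical
  have hpow : ∀ x : ℝ≥0, (x ^ #(nbrs G w)) ^ (1 / (#(nbrs G w) : ℝ)) = x := by
    intro x
    rw [one_div, NNReal.pow_rpow_inv_natCast _ hw]
  refine (Finset.sum_le_sum fun c _ => listBound_residual_le G L w c).trans ?_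
  rw [← Finset.mul_sum, listBound_eq G L w hw]
  refine mul_le_mul_right ?_ _
  calc ∑ c ∈ L w, ∏ v ∈ nbrs G w, vertexFactor G L w v c
      = ∑ c ∈ L w, ∏ v ∈ nbrs G w,
          (vertexFactor G L w v c ^ #(nbrs G w)) ^ (1 / (#(nbrs G w) : ℝ)) := by simp only [hpow]
    _ ≤ ∏ v ∈ nbrs G w, (∑ c ∈ L w, vertexFactor G L w v c ^ #(nbrs G w)) ^
          (1 / (#(nbrs G w) : ℝ)) :=
        sum_prod_rpow_inv_card_le _ _ (card_pos.1 (Nat.pos_of_ne_zero hw)) _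
    _ ≤ _ := by
        refine Finset.prod_le_prod' fun v hv => ?_
        refine le_of_le_of_eq (NNReal.rpow_le_rpow
          (sum_vertexFactor_pow_le G L w hmax (mem_nbrs.1 hv)) (by positivity)) (hpow _)

/-- The upper bound for the number of proper list colorings of a finite graph. -/
theorem listColorings_le_listBound : (listColorings G L : ℝ≥0) ≤ listBound G L := by
  classical
  induction G using WellFoundedLT.induction generalizing L with
  | ind G ih =>
    by_cases hG : ∀ v, #(nbrs G v) = 0
    · have h1 : listBound G L = ((∏ v, #(L v) : ℕ) : ℝ≥0) := by
        rw [listBound]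
        push_cast
        refine Finset.prod_congr rfl fun v _ => ?_
        rw [isolatedFactor, if_pos (hG v), card_eq_zero.1 (hG v), Finset.prod_empty, mul_one]
      rw [h1, ← Fintype.card_piFinset]
      exact_mod_cast card_filter_le _ _
    · push Not at hG
      obtain ⟨v₀, hv₀⟩ := hG
      obtain ⟨w, -, hmax⟩ := Finset.exists_max_image univ (fun v => #(nbrs G v)) ⟨v₀, mem_univ _⟩
      have hw : #(nbrs G w) ≠ 0 := by
        have := hmax v₀ (mem_univ _)
        omega
      have hlt : G.deleteIncidenceSet w < G := by
        refine lt_of_le_of_ne (G.deleteIncidenceSet_le w) fun h => hw ?_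
        rw [← h, nbrs_delete_self, card_empty]
      calc (listColorings G L : ℝ≥0)
          ≤ ∑ c ∈ L w, (listColorings (G.deleteIncidenceSet w) (residual G L w c) : ℝ≥0) := by
            exact_mod_cast listColorings_le_sum G L w
        _ ≤ ∑ c ∈ L w, listBound (G.deleteIncidenceSet w) (residual G L w c) :=
            Finset.sum_le_sum fun c _ => ih _ hlt _
        _ ≤ listBound G L :=
            sum_listBound_residual_le G L w (fun v => hmax v (mem_univ _)) hw

end Step

/-! ### Specialization to equal lists and the product over unordered edges -/

theorem numColorings_eq_listColorings {V : Type*} [Fintype V] (q : ℕ) (G : SimpleGraph V) :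
    numColorings q G = listColorings G (fun _ => (univ : Finset (Fin q))) := by
  classical
  rw [numColorings, listColorings, Fintype.piFinset_univ, ← Fintype.card_subtype,
    ← Nat.card_eq_fintype_card]
  exact Nat.card_congr
    { toFun := fun C => ⟨C, fun u v h => C.valid h⟩
      invFun := fun f => SimpleGraph.Coloring.mk f.1 fun {u v} h => f.2 u v h
      left_inv := fun C => rfl
      right_inv := fun f => rfl }

theorem bicliqueColorings_eq_listBiclique (q a b : ℕ) :
    bicliqueColorings q a b = listBiclique a b (univ : Finset (Fin q)) univ := by
  classical
  -- `listBiclique a b` sums over colorings of the part of size `b`; the swap puts the part of size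
  -- `a` outside.
  rw [listBiclique_comm]
  have h : listBiclique b a (univ : Finset (Fin q)) univ =
      #{p : (Fin a → Fin q) × (Fin b → Fin q) | ∀ j i, p.1 i ≠ p.2 j} := by
    rw [Finset.card_filter, Fintype.sum_prod_type, listBiclique, Fintype.piFinset_univ]
    refine Finset.sum_congr rfl fun x _ => ?_
    rw [avail_pow, Fintype.piFinset_univ]
    refine Finset.sum_congr rfl fun y _ => ?_
    simp only [Finset.prod_ite_zero, Finset.prod_const_one, mem_univ, true_imp_iff]
  rw [h, bicliqueColorings, numColorings, ← Fintype.card_subtype, ← Nat.card_eq_fintype_card]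
  refine Nat.card_congr
    { toFun := fun C => ⟨(fun i => C (Sum.inl i), fun j => C (Sum.inr j)),
        fun j i => C.valid (by simp)⟩
      invFun := fun p => SimpleGraph.Coloring.mk (Sum.elim p.1.1 p.1.2) ?_
      left_inv := ?_
      right_inv := fun p => rfl }
  · rintro (i | i) (j | j) hij
    · simp at hij
    · exact p.2 j i
    · exact (p.2 i j).symm
    · simp at hij
  · intro C
    ext x
    rcases x with i | j <;> rfl

/-- Every edge carries two darts, whence the square; it undoes the square root in `halfFactor`. -/
theorem prod_nbrs_eq_prod_edgeFinset {V : Type*} [Fintype V] [DecidableEq V] (G : SimpleGraph V)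
    [DecidableRel G.Adj] (e : Sym2 V → ℝ≥0) :
    ∏ v, ∏ u ∈ nbrs G v, e s(v, u) = ∏ x ∈ G.edgeFinset, e x ^ 2 := by
  have h1 : ∏ d : G.Dart, e d.edge = ∏ x ∈ G.edgeFinset, e x ^ 2 := by
    rw [← Finset.prod_fiberwise_of_maps_to (s := univ) (t := G.edgeFinset)
      (g := fun d : G.Dart => d.edge) (fun d _ => by simp)]
    refine Finset.prod_congr rfl fun x hx => ?_
    rw [Finset.prod_congr rfl (g := fun _ => e x) (fun d hd => by rw [(mem_filter.1 hd).2]),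
      Finset.prod_const, G.dart_edge_fiber_card x (SimpleGraph.mem_edgeFinset.1 hx)]
  rw [← h1, Finset.prod_sigma']
  refine Finset.prod_bij' (fun p hp => ⟨(p.1, p.2), mem_nbrs.1 (mem_sigma.1 hp).2⟩)
    (fun d _ => ⟨d.fst, d.snd⟩) ?_ ?_ ?_ ?_ ?_
  · simp
  · intro d _
    simp [mem_nbrs]
  · simp
  · simp
  · intro p hp
    rfl

theorem card_nbrs {V : Type*} [Fintype V] (G : SimpleGraph V) [DecidableRel G.Adj] (v : V) :
    #(nbrs G v) = G.degree v := by
  rw [← SimpleGraph.card_neighborFinset_eq_degree]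
  congr 1
  ext u
  simp [mem_nbrs]

theorem edgeFactor_nonneg {V : Type*} [Fintype V] (G : SimpleGraph V) [DecidableRel G.Adj]
    (q : ℕ) (x : Sym2 V) : 0 ≤ edgeFactor G q x := by
  induction x using Sym2.ind with
  | _ v u => exact Real.rpow_nonneg (Nat.cast_nonneg _) _

theorem halfFactor_univ {V : Type*} [Fintype V] (G : SimpleGraph V) [DecidableRel G.Adj] (q : ℕ)
    (v u : V) :
    halfFactor G (fun _ => (univ : Finset (Fin q))) v u =
      (edgeFactor G q s(v, u)).toNNReal ^ (1 / 2 : ℝ) := by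
  have h : (edgeFactor G q s(v, u)).toNNReal =
      (bicliqueColorings q (G.degree v) (G.degree u) : ℝ≥0) ^
        (1 / ((G.degree v : ℝ) * (G.degree u : ℝ))) := by
    rw [← NNReal.coe_inj, Real.coe_toNNReal _ (edgeFactor_nonneg G q _)]
    simp [edgeFactor]
  rw [h, ← NNReal.rpow_mul, bicliqueColorings_eq_listBiclique, halfFactor, card_nbrs, card_nbrs]
  congr! 1
  · congr!
  · ring

end ColorCount

theorem mainTheorem6 {V : Type*} [Fintype V] [DecidableEq V] (G : SimpleGraph V)
    [DecidableRel G.Adj] (hG : ∀ v : V, ¬ G.IsIsolated v) (q : ℕ) (hq : 0 < q) :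
    (ColorCount.numColorings q G : ℝ) ≤ ∏ e ∈ G.edgeFinset, ColorCount.edgeFactor G q e := by
  have hdeg : ∀ v, #(ColorCount.nbrs G v) ≠ 0 := by
    intro v h
    refine hG v fun u hu => ?_
    simpa [Finset.card_eq_zero.1 h] using ColorCount.mem_nbrs.2 hu
  have h := ColorCount.listColorings_le_listBound G (fun _ => (univ : Finset (Fin q)))
  have hbound : ColorCount.listBound G (fun _ => (univ : Finset (Fin q))) =
      ∏ e ∈ G.edgeFinset, (ColorCount.edgeFactor G q e).toNNReal := by
    rw [ColorCount.listBound, Finset.prod_congr rfl fun v _ => by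
      rw [ColorCount.isolatedFactor, if_neg (hdeg v), one_mul,
        Finset.prod_congr rfl fun u _ => ColorCount.halfFactor_univ G q v u],
      ColorCount.prod_nbrs_eq_prod_edgeFinset G
        (fun x => (ColorCount.edgeFactor G q x).toNNReal ^ (1 / 2 : ℝ))]
    refine Finset.prod_congr rfl fun x _ => ?_
    rw [← NNReal.rpow_natCast, ← NNReal.rpow_mul]
    norm_num
  rw [hbound, ← ColorCount.numColorings_eq_listColorings] at h
  calc (ColorCount.numColorings q G : ℝ)
      ≤ ((∏ e ∈ G.edgeFinset, (ColorCount.edgeFactor G q e).toNNReal : ℝ≥0) : ℝ) := by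
        exact_mod_cast h
    _ = ∏ e ∈ G.edgeFinset, ColorCount.edgeFactor G q e := by
        push_cast
        exact Finset.prod_congr rfl fun x _ =>
          Real.coe_toNNReal _ (ColorCount.edgeFactor_nonneg G q x)
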